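/- Let $(q_n)_{n\ge 0}$ be a sequence of integers with $q_n>1$, and let $a_{n,i}\ge 0$ ($n\ge 0$, $1\le i<q_n$) be integers. Define finite words over $\{0,1\}$ by $v_0=0$ and $$v_{n+1}=v_n1^{a_{n,1}}v_n1^{a_{n,2}}v_n\cdots v_n1^{a_{n,q_n-1}}v_n ,$$ let $|v_n|$ be the length of $v_n$, and let $V\in\{0,1\}^{\mathbb N}$ be the infinite word which has every $v_n$ as an initial segment. Let $X$ be the set of all $x\in\{0,1\}^{\mathbb Z}$ such that every finite subword of $x$ is a subword of $V$, with the topology induced by the product topology, and let $T:X\to X$, $(Tx)(k)=x(k+1)$, be the left shift (the rank-one subshift with cutting parameter $(q_n)$ and spacer parameter $(a_{n,i})$). Suppose that the spacer parameter is bounded, i.e. there is $B$ with $a_{n,i}\le B$ for all $n\ge 0$ and $1\le i<q_n$, and that $X$ is infinite. Then the following are equivalent: (i) $(X,T)$ is (topologically) weakly mixing: for all non-empty open $U_1,U_2,U_3,U_4\subseteq X$ there is $l\in\mathbb Z$ with $T^l(U_1)\cap U_2\ne\emptyset$ and $T^l(U_3)\cap U_4\neq\emptyset$; (ii) the maximal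 equicontinuous factor of $(X,T)$ is trivial, i.e. is the one-point system; (iii) every finite factor of $(X,T)$ is trivial, i.e. has exactly one point; (iv) for every integer $p>1$ and every $n\ge 0$ there are $m\ge n$ and $1\le i<q_m$ such that $p\nmid |v_n|+a_{m,i}$. Here a factor of $(X,T)$ is a compact metric space $Y$ with a continuous map $S:Y\to Y$ for which there is a continuous surjection $\varphi:X\to Y$ (a factor map) with $\varphi\circ T=S\circ\varphi$. It is equicontinuous if $S$ is a homeomorphism and for every $\varepsilon>0$ there is $\delta>0$ such that $d(y_1,y_2)<\delta$ implies $d(S^l y_1,S^l y_2)<\varepsilon$ for all $l\in\mathbb Z$. It is the maximal equicontinuous factor if it is equicontinuous and, for some factor map $\varphi$ onto it, every factor map from $(X,T)$ onto an equicontinuous system $(Y',S')$ is of the form $\theta\circ\varphi$ with $\theta$ a factor map from $(Y,S)$ onto $(Y',S')$. -/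

import Mathlib

open SymbolicDynamics.FullShift

universe u w

/-! ### Topological dynamics -/

/-- `φ` is a factor map from the system `(X, T)` onto the system `(Y, S)`. -/
structure IsFactorMap {X Y : Type*} [TopologicalSpace X] [TopologicalSpace Y]
    (T : X → X) (S : Y → Y) (φ : X → Y) : Prop where
  continuous : Continuous φ
  surjective : Function.Surjective φ
  semiconj : ∀ x, φ (T x) = S (φ x)

/-- `(Y, S)` is a factor of `(X, T)`. -/
def IsFactor {X Y : Type*} [TopologicalSpace X] [TopologicalSpace Y]
    (T : X → X) (S : Y → Y) : Prop :=
  ∃ φ : X → Y, IsFactorMap T S φ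

/-- `(Y, S)` is equicontinuous. All iterates `S ^ l`, `l : ℤ`, are involved, so
it is part of the notion that `S` is a homeomorphism. -/
def IsEquicontinuousSystem {Y : Type*} [MetricSpace Y] (S : Y → Y) : Prop :=
  ∃ e : Y ≃ₜ Y, ⇑e = S ∧
    ∀ ε > 0, ∃ δ > 0, ∀ y₁ y₂ : Y, dist y₁ y₂ < δ →
      ∀ l : ℤ, dist ((e ^ l) y₁) ((e ^ l) y₂) < ε

/-- `(Y, S)` is the maximal equicontinuous factor of `(X, T)`: there is a factor map
`φ` from `(X, T)` onto `(Y, S)`, `(Y, S)` is equicontinuous, and every factor map from `(X, T)`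
onto an equicontinuous compact metric system factors through `φ`.
This determines `(Y, S)` up to isomorphism. -/
def IsMaximalEquicontinuousFactor {X : Type w} [TopologicalSpace X]
    {Y : Type u} [MetricSpace Y] [CompactSpace Y]
    (T : X → X) (S : Y → Y) : Prop :=
  IsEquicontinuousSystem S ∧
  ∃ φ : X → Y, IsFactorMap T S φ ∧
    ∀ (Y' : Type u) [MetricSpace Y'] [CompactSpace Y'] (S' : Y' → Y'),
      IsEquicontinuousSystem S' → ∀ ψ : X → Y', IsFactorMap T S' ψ →
        ∃ θ : Y → Y', IsFactorMap S S' θ ∧ θ ∘ φ = ψ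

/-- Topological weak mixing of an invertible system. -/
def IsWeaklyMixing {X : Type*} [TopologicalSpace X] (T : X ≃ₜ X) : Prop :=
  ∀ U V W Z : Set X, IsOpen U → IsOpen V → IsOpen W → IsOpen Z →
    U.Nonempty → V.Nonempty → W.Nonempty → Z.Nonempty →
      ∃ l : ℤ, (⇑(T ^ l) '' U ∩ V).Nonempty ∧ (⇑(T ^ l) '' W ∩ Z).Nonempty

/-- The left shift `(T x) k = x (k + 1)` as a self-homeomorphism of a two-sided subshift. -/
def subshiftHomeo {A : Type*} [TopologicalSpace A] (X : Subshift A ℤ) :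
    X.carrier ≃ₜ X.carrier where
  toFun x := ⟨shift 1 x.1, X.mapsTo 1 x.2⟩
  invFun x := ⟨shift (-1) x.1, X.mapsTo (-1) x.2⟩
  left_inv x := by
    apply Subtype.ext
    funext k
    simp
  right_inv x := by
    apply Subtype.ext
    funext k
    simp
  continuous_toFun := by
    exact Continuous.subtype_mk ((continuous_shift 1).comp continuous_subtype_val) _
  continuous_invFun := by
    exact Continuous.subtype_mk ((continuous_shift (-1)).comp continuous_subtype_val) _

theorem subshiftHomeo_apply {A : Type*} [TopologicalSpace A] (X : Subshift A ℤ)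
    (x : X.carrier) (k : ℤ) : (subshiftHomeo X x).1 k = x.1 (k + 1) := by
  simp [subshiftHomeo, add_comm]

/-! ### Rank-one subshifts -/

/-- The rank-one generating sequence with cutting parameter `q` and spacer parameter `a`
(only the values `a n i` with `1 ≤ i < q n` matter):
`v₀ = 0` and `v_{n+1} = v_n 1^{a n 1} v_n 1^{a n 2} v_n ⋯ v_n 1^{a n (q n - 1)} v_n`. -/
def genWord (q : ℕ → ℕ) (a : ℕ → ℕ → ℕ) : ℕ → List (Fin 2)
  | 0 => [0]
  | n + 1 => genWord q a n ++
      (List.range' 1 (q n - 1)).flatMap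
        (fun i => List.replicate (a n i) 1 ++ genWord q a n)

/-- The infinite rank-one word `V`, the limit of the words `v_n`. When every `q n` is at least `2`
the word `v_k` is longer than `k`, so its letter at position `k` exists; see
`infWord_eq` for the independence of the level. -/
def infWord (q : ℕ → ℕ) (a : ℕ → ℕ → ℕ) (k : ℕ) : Fin 2 :=
  (genWord q a k).getD k 0

theorem genWord_prefix_succ (q : ℕ → ℕ) (a : ℕ → ℕ → ℕ) (n : ℕ) :
    genWord q a n <+: genWord q a (n + 1) := by
  rw [genWord]
  exact List.prefix_append _ _

theorem genWord_prefix (q : ℕ → ℕ) (a : ℕ → ℕ → ℕ) {m n : ℕ} (h : m ≤ n) :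
    genWord q a m <+: genWord q a n := by
  induction n, h using Nat.le_induction with
  | base => exact List.prefix_rfl
  | succ n _ ih => exact ih.trans (genWord_prefix_succ q a n)

theorem lt_length_genWord (q : ℕ → ℕ) (a : ℕ → ℕ → ℕ) (hq : ∀ n, 1 < q n) (n : ℕ) :
    n < (genWord q a n).length := by
  induction n with
  | zero => simp [genWord]
  | succ n ih =>
    obtain ⟨r, hr⟩ : ∃ r, q n - 1 = r + 1 := ⟨q n - 2, by have := hq n; omega⟩
    rw [genWord, hr, List.range'_succ]
    simp only [List.flatMap_cons, List.length_append, List.length_replicate]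
    omega

theorem infWord_eq (q : ℕ → ℕ) (a : ℕ → ℕ → ℕ) (hq : ∀ n, 1 < q n) (n k : ℕ)
    (hk : k < (genWord q a n).length) : infWord q a k = (genWord q a n)[k] := by
  have h1 := lt_length_genWord q a hq k
  rw [infWord, List.getD_eq_getElem _ _ h1]
  rcases le_total k n with h | h
  · exact (genWord_prefix q a h).getElem h1
  · exact ((genWord_prefix q a h).getElem hk).symm

/-- The rank-one subshift: all bi-infinite words `x` over `{0, 1}` each of whose finite subwords
`x k, x (k + 1), …, x (k + L - 1)` is a subword of the infinite rank-one word. -/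
def rankOneSubshift (q : ℕ → ℕ) (a : ℕ → ℕ → ℕ) : Subshift (Fin 2) ℤ where
  carrier := {x | ∀ (k : ℤ) (L : ℕ), ∃ m : ℕ, ∀ j < L, x (k + j) = infWord q a (m + j)}
  isClosed := by
    simp only [Set.ofPred_forall]
    refine isClosed_iInter fun k => isClosed_iInter fun L => ?_
    have hc : Continuous fun (x : ℤ → Fin 2) (j : Fin L) => x (k + (j : ℕ)) := by fun_prop
    have := (isClosed_discrete
      {w : Fin L → Fin 2 | ∃ m : ℕ, ∀ j : Fin L, w j = infWord q a (m + j)}).preimage hc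
    convert this using 1
    ext x
    simp [Fin.forall_iff]
  mapsTo := by
    intro g x hx k L
    obtain ⟨m, hm⟩ := hx (g + k) L
    exact ⟨m, fun j hj => by simpa [add_assoc] using hm j hj⟩

/-! The cycle (i) ⇒ (ii) ⇒ (iii) ⇒ (iv) ⇒ (i) is proved. The first two implications are soft: weak
mixing sends two nearby points of an equicontinuous factor close to arbitrary targets at one common
time, and finite factors are equicontinuous.

For (iii) ⇒ (iv), suppose `p` divides every `|v_n| + a m i` with `m ≥ n`. Then `p` divides the
position of every `v_n` block of `V`. Positions modulo `p` can be read off a long enough window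
(`exists_window_modEq`): two equal windows with different block structures would force a long
stretch of `V` to have a period below `2 |v_n|`, which is impossible when `X` is infinite. Reading
this residue maps `X` onto `ℤ/p` (`exists_cyclic_quotient`).

For (iv) ⇒ (i), weak mixing reduces to writing every integer as `(k₁ - k₂) - (k₃ - k₄)` with all
`kᵢ` occurrences of `v_n` (`distDiff_eq_univ`). Since spacers are bounded, from some level on the
same spacer values occur at all levels. Inserting large blocks separated by `s` and by `s'`
therefore changes such a double difference by `s - s'`. Together with the block positions
themselves, this yields the whole subgroup generated by the numbers `|v_n| + s`, which is `ℤ` by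
(iv). -/

/-! ### Spacers and block positions in the infinite word -/

/-- The spacer after the `j`-th block `v_n` of the infinite rank-one word. -/
def spacer (q : ℕ → ℕ) (a : ℕ → ℕ → ℕ) (n j : ℕ) : ℕ :=
  -- When `q n ∣ j + 1`, the block ends a copy of `v_{n+1}`, and its spacer is the one following
  -- that copy. The condition `1 < q n` serves termination.
  if h : 1 < q n ∧ q n ∣ j + 1 then spacer q a (n + 1) ((j + 1) / q n - 1)
  else a n ((j + 1) % q n)
termination_by j
decreasing_by
  obtain ⟨h1, k, hk⟩ := h
  rw [hk, Nat.mul_div_cancel_left _ (by omega)]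
  have : 2 * k ≤ q n * k := Nat.mul_le_mul_right _ h1
  rcases k with _ | k
  · simp at hk
  · omega

/-- The position of the `j`-th block `v_n` in the infinite rank-one word. -/
def blockPos (q : ℕ → ℕ) (a : ℕ → ℕ → ℕ) (n j : ℕ) : ℕ :=
  j * (genWord q a n).length + ∑ i ∈ Finset.range j, spacer q a n i

section

variable {q : ℕ → ℕ} {a : ℕ → ℕ → ℕ}

theorem spacer_of_lt {n i : ℕ} (h : i + 1 < q n) : spacer q a n i = a n (i + 1) := by
  rw [spacer, dif_neg, Nat.mod_eq_of_lt h]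
  rintro ⟨-, h2⟩
  exact absurd (Nat.le_of_dvd (by omega) h2) (by omega)

theorem spacer_mul_add_of_lt {n t r : ℕ} (h : r + 1 < q n) :
    spacer q a n (t * q n + r) = spacer q a n r := by
  have h1 : (t * q n + r + 1) % q n = r + 1 := by
    rw [add_assoc, add_comm, Nat.add_mul_mod_self_right, Nat.mod_eq_of_lt h]
  rw [spacer_of_lt h, spacer, dif_neg, h1]
  rintro ⟨-, h2⟩
  rw [Nat.dvd_iff_mod_eq_zero] at h2
  omega

theorem spacer_mul_add_sub_one (hq : ∀ n, 1 < q n) (n t : ℕ) :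
    spacer q a n (t * q n + (q n - 1)) = spacer q a (n + 1) t := by
  have h := hq n
  have h1 : t * q n + (q n - 1) + 1 = (t + 1) * q n := by
    rw [add_mul, one_mul]; omega
  rw [spacer, dif_pos ⟨h, by rw [h1]; exact Dvd.intro_left _ rfl⟩, h1,
    Nat.mul_div_cancel _ (by omega), Nat.add_sub_cancel]

theorem exists_spacer_eq (hq : ∀ n, 1 < q n) {n m i : ℕ} (hm : n ≤ m) (h1 : 1 ≤ i)
    (hi : i < q m) : ∃ t, spacer q a n t = a m i := by
  induction hm using Nat.decreasingInduction with
  | self => exact ⟨i - 1, by rw [spacer_of_lt (by omega), Nat.sub_add_cancel h1]⟩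
  | of_succ n _ ih =>
    obtain ⟨t, ht⟩ := ih
    exact ⟨t * q n + (q n - 1), by rw [spacer_mul_add_sub_one hq, ht]⟩

theorem exists_eq_spacer (hq : ∀ n, 1 < q n) (n t : ℕ) :
    ∃ m ≥ n, ∃ i, 1 ≤ i ∧ i < q m ∧ spacer q a n t = a m i := by
  induction t using Nat.strong_induction_on generalizing n with
  | _ t ih =>
    have h := hq n
    by_cases hd : q n ∣ t + 1
    · obtain ⟨k, hk⟩ := hd
      obtain ⟨j, rfl⟩ : ∃ j, k = j + 1 := ⟨k - 1, by
        rcases k with _ | k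
        · simp at hk
        · simp⟩
      have h2 : t = j * q n + (q n - 1) := by
        rw [mul_add, mul_one, mul_comm] at hk; omega
      have h3 : j < t := by
        have : j * 1 ≤ j * q n := Nat.mul_le_mul_left _ (by omega)
        omega
      obtain ⟨m, hm, i, h4⟩ := ih j h3 (n + 1)
      exact ⟨m, by omega, i, by rwa [h2, spacer_mul_add_sub_one hq]⟩
    · refine ⟨n, le_rfl, (t + 1) % q n, ?_, Nat.mod_lt _ (by omega), ?_⟩
      · rw [Nat.dvd_iff_mod_eq_zero] at hd
        omega
      · rw [spacer, dif_neg (fun h => hd h.2)]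

@[simp]
theorem blockPos_zero (n : ℕ) : blockPos q a n 0 = 0 := by simp [blockPos]

theorem blockPos_succ (n j : ℕ) : blockPos q a n (j + 1) =
    blockPos q a n j + (genWord q a n).length + spacer q a n j := by
  simp only [blockPos, Finset.sum_range_succ]
  ring

/-- The word `v_n 1^{a n 1} v_n ⋯ 1^{a n r} v_n`. -/
def partialWord (q : ℕ → ℕ) (a : ℕ → ℕ → ℕ) (n r : ℕ) : List (Fin 2) :=
  genWord q a n ++
      (List.range' 1 r).flatMap (fun i => List.replicate (a n i) 1 ++ genWord q a n)

theorem partialWord_succ (n r : ℕ) : partialWord q a n (r + 1) =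
    partialWord q a n r ++ List.replicate (a n (r + 1)) 1 ++ genWord q a n := by
  simp [partialWord, List.range'_1_concat, add_comm]

theorem genWord_succ (n : ℕ) : genWord q a (n + 1) = partialWord q a n (q n - 1) := rfl

theorem length_partialWord {n r : ℕ} (h : r < q n) :
    (partialWord q a n r).length = blockPos q a n r + (genWord q a n).length := by
  induction r with
  | zero => simp [partialWord]
  | succ r ih =>
    rw [partialWord_succ, blockPos_succ, spacer_of_lt h]
    simp only [List.length_append, List.length_replicate]
    rw [ih (by omega)]

theorem length_genWord_succ (hq : ∀ n, 1 < q n) (n : ℕ) : (genWord q a (n + 1)).length =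
    blockPos q a n (q n - 1) + (genWord q a n).length := by
  rw [genWord_succ, length_partialWord (by have := hq n; omega)]

theorem partialWord_prefix {n r s : ℕ} (h : r ≤ s) :
    partialWord q a n r <+: partialWord q a n s := by
  induction s, h using Nat.le_induction with
  | base => exact List.prefix_rfl
  | succ s _ ih =>
    rw [partialWord_succ, List.append_assoc]
    exact ih.trans (List.prefix_append _ _)

theorem infWord_eq_partialWord (hq : ∀ n, 1 < q n) {n r k : ℕ} (h : r < q n)
    (hk : k < (partialWord q a n r).length) : infWord q a k = (partialWord q a n r)[k] := by
  have h1 : partialWord q a n r <+: genWord q a (n + 1) := by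
    rw [genWord_succ]; exact partialWord_prefix (by omega)
  rw [infWord_eq q a hq (n + 1) k (hk.trans_le h1.length_le)]
  exact (h1.getElem hk).symm

theorem infWord_blockPos_add_of_lt (hq : ∀ n, 1 < q n) {n r t : ℕ} (h : r < q n)
    (ht : t < (genWord q a n).length) :
    infWord q a (blockPos q a n r + t) = infWord q a t := by
  have h0 := length_partialWord (a := a) h
  rw [infWord_eq_partialWord hq h (by omega), infWord_eq q a hq n t ht]
  cases r with
  | zero => simp [partialWord]
  | succ r =>
    have h1 := length_partialWord (a := a) (show r < q n by omega)
    have h2 := blockPos_succ (q := q) (a := a) n r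
    rw [spacer_of_lt h] at h2
    simp only [partialWord_succ]
    rw [List.getElem_append_right (by simp; omega)]
    congr 1
    simp
    omega

theorem infWord_blockPos_add_length_add_of_lt (hq : ∀ n, 1 < q n) {n r t : ℕ}
    (h : r + 1 < q n) (ht : t < spacer q a n r) :
    infWord q a (blockPos q a n r + (genWord q a n).length + t) = 1 := by
  have h0 := length_partialWord (a := a) h
  have h1 := length_partialWord (a := a) (show r < q n by omega)
  have h2 := blockPos_succ (q := q) (a := a) n r
  rw [infWord_eq_partialWord hq h (by omega)]
  rw [spacer_of_lt h] at ht h2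
  simp only [partialWord_succ]
  rw [List.getElem_append_left (by simp; omega), List.getElem_append_right (by omega)]
  simp

theorem blockPos_mul_add (hq : ∀ n, 1 < q n) (n t : ℕ) {r : ℕ} (hr : r < q n) :
    blockPos q a n (t * q n + r) = blockPos q a (n + 1) t + blockPos q a n r := by
  induction t generalizing r with
  | zero => simp
  | succ t ih =>
    induction r with
    | zero =>
      have h := hq n
      have h1 : (t + 1) * q n + 0 = t * q n + (q n - 1) + 1 := by
        rw [add_mul, one_mul]; omega
      rw [h1, blockPos_succ, ih (by omega), spacer_mul_add_sub_one hq, blockPos_succ (n + 1),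
        length_genWord_succ hq, blockPos_zero]
      ring
    | succ r ih' =>
      rw [← add_assoc, blockPos_succ, ih' (by omega), spacer_mul_add_of_lt hr, blockPos_succ n r]
      ring

/-- Induction on `j` over all levels at once: block `j` of level `n` lies in block `j / q n < j` of
level `n + 1`, whose content is already known to be `v_{n+1}`. -/
theorem infWord_blockPos (hq : ∀ n, 1 < q n) (n j : ℕ) :
    (∀ t < (genWord q a n).length, infWord q a (blockPos q a n j + t) = infWord q a t) ∧
    ∀ t < spacer q a n j,
      infWord q a (blockPos q a n j + (genWord q a n).length + t) = 1 := by
  induction j using Nat.strong_induction_on generalizing n with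
  | _ j ih =>
    have h := hq n
    rcases Nat.eq_zero_or_pos j with rfl | hj
    · exact ⟨fun t ht => infWord_blockPos_add_of_lt hq (by omega) ht,
        fun t ht => infWord_blockPos_add_length_add_of_lt hq (by omega) ht⟩
    have hr : j % q n < q n := Nat.mod_lt _ (by omega)
    have hd : j / q n < j := Nat.div_lt_self hj h
    have hj' : j = j / q n * q n + j % q n := by rw [mul_comm]; exact (Nat.div_add_mod _ _).symm
    obtain ⟨h1, h2⟩ := ih _ hd (n + 1)
    have hL := length_genWord_succ (a := a) hq n
    have hb := blockPos_mul_add (a := a) hq n (j / q n) hr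
    rw [← hj'] at hb
    rw [hb]
    have hmono : ∀ r s, r ≤ s → blockPos q a n r ≤ blockPos q a n s := fun r s hrs =>
      monotone_nat_of_le_succ (fun k => by rw [blockPos_succ]; omega) hrs
    constructor
    · intro t ht
      have := hmono (j % q n) (q n - 1) (by omega)
      rw [add_assoc, h1 _ (by omega), infWord_blockPos_add_of_lt hq hr ht]
    · intro t ht
      by_cases hlast : j % q n + 1 < q n
      · have h3 : spacer q a n j = spacer q a n (j % q n) := by
          rw [hj', spacer_mul_add_of_lt hlast, ← hj']
        rw [h3] at ht
        have h4 := hmono (j % q n + 1) (q n - 1) (by omega)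
        rw [blockPos_succ] at h4
        rw [add_assoc, add_assoc, h1 _ (by omega), ← add_assoc,
          infWord_blockPos_add_length_add_of_lt hq hlast ht]
      -- The last `v_n` inside a `v_{n+1}`: its spacer lies outside that copy, so the second half of
      -- the induction hypothesis applies.
      · have hl : j % q n = q n - 1 := by omega
        have h3 : spacer q a n j = spacer q a (n + 1) (j / q n) := by
          rw [hj', hl, spacer_mul_add_sub_one hq, ← hl, ← hj']
        rw [h3] at ht
        rw [hl, add_assoc (blockPos q a (n + 1) _), ← hL, h2 t ht]

theorem length_genWord_pos (hq : ∀ n, 1 < q n) (n : ℕ) : 0 < (genWord q a n).length :=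
  (Nat.zero_le _).trans_lt (lt_length_genWord q a hq n)

theorem blockPos_strictMono (hq : ∀ n, 1 < q n) (n : ℕ) : StrictMono (blockPos q a n) :=
  strictMono_nat_of_lt_succ fun k => by
    have := length_genWord_pos (a := a) hq n
    rw [blockPos_succ]; omega

theorem exists_blockPos_le_lt (hq : ∀ n, 1 < q n) (n k : ℕ) :
    ∃ j, blockPos q a n j ≤ k ∧ k < blockPos q a n (j + 1) := by
  have hex : ∃ j, k < blockPos q a n (j + 1) :=
    ⟨k, (Nat.lt_succ_self k).trans_le ((blockPos_strictMono hq n).le_apply)⟩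
  refine ⟨Nat.find hex, ?_, Nat.find_spec hex⟩
  by_contra hlt
  rcases hf : Nat.find hex with _ | j
  · simp [hf] at hlt
  · rw [hf] at hlt
    exact Nat.find_min hex (m := j) (by omega) (by omega)

theorem spacer_le (hq : ∀ n, 1 < q n) {B : ℕ} (hB : ∀ n i, 1 ≤ i → i < q n → a n i ≤ B)
    (n j : ℕ) : spacer q a n j ≤ B := by
  obtain ⟨m, -, i, h1, h2, h3⟩ := exists_eq_spacer (a := a) hq n j
  exact h3 ▸ hB m i h1 h2

theorem blockPos_succ_le (hq : ∀ n, 1 < q n) {B : ℕ}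
    (hB : ∀ n i, 1 ≤ i → i < q n → a n i ≤ B) (n j : ℕ) :
    blockPos q a n (j + 1) ≤ blockPos q a n j + ((genWord q a n).length + B) := by
  have := spacer_le hq hB n j
  rw [blockPos_succ]; omega

theorem exists_blockPos_mem (hq : ∀ n, 1 < q n) {B : ℕ}
    (hB : ∀ n i, 1 ≤ i → i < q n → a n i ≤ B) (n k : ℕ) :
    ∃ j, k ≤ blockPos q a n j ∧ blockPos q a n j ≤ k + ((genWord q a n).length + B) := by
  obtain ⟨j, h1, h2⟩ := exists_blockPos_le_lt (a := a) hq n k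
  have := blockPos_succ_le hq hB n j
  exact ⟨j + 1, by omega, by omega⟩

theorem infWord_zero : infWord q a 0 = 0 := by simp [infWord, genWord]

end

/-! ### Equicontinuous and finite factors -/

theorem IsFactorMap.semiconj_zpow {X Y : Type*} [TopologicalSpace X] [TopologicalSpace Y]
    {T : X ≃ₜ X} {e : Y ≃ₜ Y} {φ : X → Y} (h : IsFactorMap T e φ) (l : ℤ) (x : X) :
    φ ((T ^ l) x) = (e ^ l) (φ x) := by
  have hinv : ∀ x, φ (T⁻¹ x) = e⁻¹ (φ x) := fun x => by
    apply e.injective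
    rw [← h.semiconj]
    change φ (T (T.symm x)) = e (e.symm (φ x))
    simp
  induction l generalizing x with
  | zero => simp
  | succ n ih =>
    rw [zpow_add_one, zpow_add_one, Homeomorph.mul_apply, Homeomorph.mul_apply, ih, h.semiconj]
  | pred n ih =>
    rw [zpow_sub_one, zpow_sub_one, Homeomorph.mul_apply, Homeomorph.mul_apply, ih, hinv]

/-- Two points starting within `δ / 2` of `y₁` can be moved at one time `l`, one near `y₁` and the
other near `y₂`. Three distances below `dist y₁ y₂ / 3` then contradict the triangle inequality. -/
theorem IsWeaklyMixing.subsingleton_of_isEquicontinuousSystem {X Y : Type*} [TopologicalSpace X]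
    [MetricSpace Y] {T : X ≃ₜ X} (hT : IsWeaklyMixing T) {S : Y → Y}
    (hS : IsEquicontinuousSystem S) {φ : X → Y} (hφ : IsFactorMap T S φ) : Subsingleton Y := by
  obtain ⟨e, rfl, he⟩ := hS
  refine ⟨fun y₁ y₂ => ?_⟩
  by_contra hne
  have hd : 0 < dist y₁ y₂ := dist_pos.2 hne
  obtain ⟨δ, hδ, hδ'⟩ := he (dist y₁ y₂ / 3) (by positivity)
  have hopen : ∀ y r, IsOpen (φ ⁻¹' Metric.ball y r) := fun y r =>
    Metric.isOpen_ball.preimage hφ.continuous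
  have hnon : ∀ y r, 0 < r → (φ ⁻¹' Metric.ball y r).Nonempty := fun y r hr => by
    obtain ⟨x, rfl⟩ := hφ.surjective y
    exact ⟨x, by simpa using hr⟩
  obtain ⟨l, ⟨_, ⟨u, hu, rfl⟩, hu'⟩, ⟨_, ⟨w, hw, rfl⟩, hw'⟩⟩ :=
    hT _ _ _ _ (hopen y₁ (δ / 2)) (hopen y₁ (dist y₁ y₂ / 3)) (hopen y₁ (δ / 2))
      (hopen y₂ (dist y₁ y₂ / 3)) (hnon _ _ (by positivity)) (hnon _ _ (by positivity))
      (hnon _ _ (by positivity)) (hnon _ _ (by positivity))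
  simp only [Set.mem_preimage, Metric.mem_ball, hφ.semiconj_zpow] at hu hu' hw hw'
  have h1 : dist (φ u) (φ w) < δ := by
    have := dist_triangle_right (φ u) (φ w) y₁
    linarith
  have h2 := hδ' _ _ h1 l
  have h3 := dist_triangle4 y₁ ((e ^ l) (φ u)) ((e ^ l) (φ w)) y₂
  rw [dist_comm y₁ ((e ^ l) (φ u))] at h3
  linarith

theorem IsWeaklyMixing.isMaximalEquicontinuousFactor_punit {X : Type w} [TopologicalSpace X]
    [Nonempty X] {T : X ≃ₜ X} (hT : IsWeaklyMixing T) :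
    IsMaximalEquicontinuousFactor T (id : PUnit.{u + 1} → PUnit.{u + 1}) := by
  refine ⟨⟨1, rfl, fun ε hε => ⟨1, one_pos, fun y₁ y₂ _ l => by simpa using hε⟩⟩,
    fun _ => PUnit.unit, ⟨continuous_const, fun y => ⟨Classical.arbitrary X, rfl⟩, fun _ => rfl⟩,
    fun Y' _ _ S' hS' ψ hψ => ?_⟩
  have := hT.subsingleton_of_isEquicontinuousSystem hS' hψ
  refine ⟨fun _ => ψ (Classical.arbitrary X), ⟨continuous_const,
    fun y => ⟨PUnit.unit, Subsingleton.elim _ _⟩, fun _ => Subsingleton.elim _ _⟩,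
    funext fun _ => Subsingleton.elim _ _⟩

theorem isEquicontinuousSystem_of_finite {Y : Type*} [MetricSpace Y] [Finite Y] {S : Y → Y}
    (hS : Function.Surjective S) : IsEquicontinuousSystem S := by
  have hb : Function.Bijective S := Finite.surjective_iff_bijective.1 hS
  refine ⟨(Equiv.ofBijective S hb).toHomeomorphOfDiscrete, rfl, fun ε hε => ?_⟩
  obtain ⟨δ, hδ, h⟩ : ∃ δ > 0, ∀ y₁ y₂ : Y, dist y₁ y₂ < δ → y₁ = y₂ := by
    obtain ⟨δ, hδ, h⟩ : ∃ δ > 0, ∀ z : Y × Y, 0 < dist z.1 z.2 → δ ≤ dist z.1 z.2 := by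
      by_cases hne : Nonempty {z : Y × Y // 0 < dist z.1 z.2}
      · obtain ⟨z, hz⟩ := Finite.exists_min (fun z : {z : Y × Y // 0 < dist z.1 z.2} =>
          dist z.1.1 z.1.2)
        exact ⟨_, z.2, fun w hw => hz ⟨w, hw⟩⟩
      · exact ⟨1, one_pos, fun z hz => absurd ⟨⟨z, hz⟩⟩ hne⟩
    refine ⟨δ, hδ, fun y₁ y₂ hy => ?_⟩
    by_contra hne
    exact absurd (h (y₁, y₂) (dist_pos.2 hne)) (not_le.2 hy)
  refine ⟨δ, hδ, fun y₁ y₂ hy l => ?_⟩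
  rw [h _ _ hy, dist_self]
  exact hε

theorem IsMaximalEquicontinuousFactor.card_eq_one {X : Type w} [TopologicalSpace X]
    {T : X ≃ₜ X} (hT : IsMaximalEquicontinuousFactor T (id : PUnit.{u + 1} → PUnit.{u + 1}))
    (Y : Type u) [MetricSpace Y] [CompactSpace Y] (S : Y → Y) [Finite Y] (h : IsFactor T S) :
    Nat.card Y = 1 := by
  obtain ⟨ψ, hψ⟩ := h
  have hS : Function.Surjective S := fun y => by
    obtain ⟨x, rfl⟩ := hψ.surjective y
    exact ⟨ψ (T.symm x), by rw [← hψ.semiconj, T.apply_symm_apply]⟩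
  obtain ⟨-, φ, -, hφ⟩ := hT
  obtain ⟨θ, hθ, -⟩ := hφ Y S (isEquicontinuousSystem_of_finite hS) ψ hψ
  rw [Nat.card_eq_one_iff_unique]
  exact ⟨hθ.surjective.subsingleton, ⟨θ PUnit.unit⟩⟩

/-- If all finite factors are trivial, then so is every finite locally constant quotient. -/
theorem card_eq_one_of_isLocallyConstant {X : Type w} [TopologicalSpace X] {T : X → X}
    (h : ∀ (Y : Type u) [MetricSpace Y] [CompactSpace Y] (S : Y → Y), Continuous S → Finite Y →
        IsFactor T S → Nat.card Y = 1)
    {Y : Type u} [Finite Y] {S : Y → Y} {φ : X → Y} (hφ : IsLocallyConstant φ)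
    (hsurj : Function.Surjective φ) (hsemi : ∀ x, φ (T x) = S (φ x)) : Nat.card Y = 1 := by
  obtain ⟨n, ⟨f⟩⟩ := Finite.exists_equiv_fin Y
  let _ : MetricSpace Y := MetricSpace.induced (fun y => ((f y : ℕ) : ℝ))
    (fun y₁ y₂ hy => f.injective (Fin.ext (Nat.cast_injective (R := ℝ) hy))) inferInstance
  exact h Y S continuous_of_discreteTopology inferInstance ⟨φ, hφ.continuous, hsurj, hsemi⟩

/-! ### Occurrences of blocks -/

section

variable {q : ℕ → ℕ} {a : ℕ → ℕ → ℕ}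

/-- The spacer ranges decrease with the level and are finite subsets of `[0, B]`, so they are
constant from a level of minimal cardinality on. -/
theorem exists_forall_ge_range_spacer_subset (hq : ∀ n, 1 < q n) {B : ℕ}
    (hB : ∀ n i, 1 ≤ i → i < q n → a n i ≤ B) :
    ∃ M, ∀ m ≥ M, Set.range (spacer q a M) ⊆ Set.range (spacer q a m) := by
  have hfin : ∀ m, (Set.range (spacer q a m)).Finite := fun m =>
    (Set.finite_Iic B).subset (Set.range_subset_iff.2 fun j => spacer_le hq hB m j)
  let M := Function.argmin (fun m => (Set.range (spacer q a m)).ncard)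
  refine ⟨M, fun m hm => ?_⟩
  have hsub : Set.range (spacer q a m) ⊆ Set.range (spacer q a M) := by
    rintro _ ⟨t, rfl⟩
    obtain ⟨k, hk, i, h1, h2, h3⟩ := exists_eq_spacer (a := a) hq m t
    rw [h3]
    exact exists_spacer_eq hq (hm.trans hk) h1 h2
  have hle : (Set.range (spacer q a M)).ncard ≤ (Set.range (spacer q a m)).ncard :=
    Function.argmin_le (fun m => (Set.range (spacer q a m)).ncard) m
  exact (Set.eq_of_subset_of_ncard_le hsub hle (hfin M)).ge

/-- The positions at which the block `v_n` occurs in the infinite word. -/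
def blockOcc (q : ℕ → ℕ) (a : ℕ → ℕ → ℕ) (n : ℕ) : Set ℕ :=
  {k | ∀ t < (genWord q a n).length, infWord q a (k + t) = infWord q a t}

/-- The differences between two distances of occurrences of `v_n`. -/
def distDiff (q : ℕ → ℕ) (a : ℕ → ℕ → ℕ) (n : ℕ) : Set ℤ :=
  {c | ∃ k₁ ∈ blockOcc q a n, ∃ k₂ ∈ blockOcc q a n, ∃ k₃ ∈ blockOcc q a n,
    ∃ k₄ ∈ blockOcc q a n, c = ((k₁ : ℤ) - k₂) - (k₃ - k₄)}

theorem blockPos_mem_blockOcc (hq : ∀ n, 1 < q n) (n j : ℕ) :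
    blockPos q a n j ∈ blockOcc q a n :=
  (infWord_blockPos hq n j).1

theorem blockPos_add_mem_blockOcc (hq : ∀ n, 1 < q n) {n m j k : ℕ} (hk : k ∈ blockOcc q a n)
    (hkm : k + (genWord q a n).length ≤ (genWord q a m).length) :
    blockPos q a m j + k ∈ blockOcc q a n := fun t ht => by
  rw [add_assoc, (infWord_blockPos hq m j).1 _ (by omega), hk t ht]

theorem distDiff_neg {n : ℕ} {c : ℤ} (hc : c ∈ distDiff q a n) : -c ∈ distDiff q a n := by
  obtain ⟨k₁, h1, k₂, h2, k₃, h3, k₄, h4, rfl⟩ := hc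
  exact ⟨k₃, h3, k₄, h4, k₁, h1, k₂, h2, by ring⟩

/-- Move `k₁` and `k₂` into consecutive copies of a large `v_m` separated by `s`, and `k₃`, `k₄`
into copies separated by `s'`. The two distances grow by `|v_m| + s` and `|v_m| + s'`, and `|v_m|`
cancels. -/
theorem distDiff_add_sub (hq : ∀ n, 1 < q n) {n M : ℕ} {c : ℤ} {s s' : ℕ}
    (hc : c ∈ distDiff q a n) (hs : ∀ m ≥ M, s ∈ Set.range (spacer q a m))
    (hs' : ∀ m ≥ M, s' ∈ Set.range (spacer q a m)) :
    c + ((s : ℤ) - s') ∈ distDiff q a n := by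
  obtain ⟨k₁, h1, k₂, h2, k₃, h3, k₄, h4, rfl⟩ := hc
  let m := M + k₁ + k₂ + k₃ + k₄ + (genWord q a n).length
  have hm : m < (genWord q a m).length := lt_length_genWord q a hq m
  obtain ⟨t, ht⟩ := hs m (by omega)
  obtain ⟨t', ht'⟩ := hs' m (by omega)
  refine ⟨_, blockPos_add_mem_blockOcc hq (m := m) (j := t + 1) h1 (by omega),
    _, blockPos_add_mem_blockOcc hq (m := m) (j := t) h2 (by omega),
    _, blockPos_add_mem_blockOcc hq (m := m) (j := t' + 1) h3 (by omega),
    _, blockPos_add_mem_blockOcc hq (m := m) (j := t') h4 (by omega), ?_⟩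
  rw [blockPos_succ, blockPos_succ, ht, ht']
  push_cast
  ring

theorem distDiff_eq_univ (hq : ∀ n, 1 < q n) {M n : ℕ}
    (hM : ∀ m ≥ M, Set.range (spacer q a M) ⊆ Set.range (spacer q a m)) (hn : M ≤ n)
    (h : ∀ p : ℕ, 1 < p → ∃ m ≥ n, ∃ i : ℕ, 1 ≤ i ∧ i < q m ∧
      ¬ p ∣ (genWord q a n).length + a m i) (c : ℤ) : c ∈ distDiff q a n := by
  let G : Set ℤ := {x | ∃ i j, x = (spacer q a n i : ℤ) - spacer q a n j}
  let H := AddSubgroup.closure G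
  let x₀ : ℤ := (genWord q a n).length + spacer q a n 0
  have hGH : ∀ i j, (spacer q a n i : ℤ) - spacer q a n j ∈ H := fun i j =>
    AddSubgroup.subset_closure ⟨i, j, rfl⟩
  have hrange : ∀ i, ∀ m ≥ M, spacer q a n i ∈ Set.range (spacer q a m) := fun i m hm => by
    refine hM m hm ?_
    obtain ⟨k, hk, i', h1, h2, h3⟩ := exists_eq_spacer (a := a) hq n i
    rw [h3]
    exact exists_spacer_eq hq (hn.trans hk) h1 h2
  -- The set of double differences is invariant under translation by `H`, the group generated by
  -- spacer differences. Modulo `H`, block `j` sits at `j * x₀`, so every coset of `H` in `ℤ x₀ + H`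
  -- is met.
  have hH : ∀ x ∈ H, ∀ d ∈ distDiff q a n, d + x ∈ distDiff q a n ∧ d - x ∈ distDiff q a n := by
    intro x hx
    induction hx using AddSubgroup.closure_induction with
    | mem x hx =>
      obtain ⟨i, j, rfl⟩ := hx
      intro d hd
      refine ⟨distDiff_add_sub hq hd (hrange i) (hrange j), ?_⟩
      have := distDiff_add_sub hq hd (hrange j) (hrange i)
      rwa [← neg_sub, ← sub_eq_add_neg] at this
    | zero => simp
    | add x y _ _ hx hy =>
      intro d hd
      rw [← add_assoc, ← sub_sub]
      exact ⟨(hy _ (hx d hd).1).1, (hy _ (hx d hd).2).2⟩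
    | neg x _ hx =>
      intro d hd
      rw [← sub_eq_add_neg, sub_neg_eq_add]
      exact (hx d hd).symm
  have hpos : ∀ j : ℕ, (blockPos q a n j : ℤ) - j * x₀ ∈ H := fun j => by
    induction j with
    | zero => simp
    | succ j ih =>
      have := H.add_mem ih (hGH j 0)
      rw [blockPos_succ]
      push_cast
      convert this using 1
      ring
  have hblock : ∀ j : ℕ, (blockPos q a n j : ℤ) ∈ distDiff q a n := fun j =>
    ⟨_, blockPos_mem_blockOcc hq n j, _, blockPos_mem_blockOcc hq n 0,
      _, blockPos_mem_blockOcc hq n 0, _, blockPos_mem_blockOcc hq n 0, by simp⟩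
  have hnat : ∀ (j : ℕ), ∀ x ∈ H, j * x₀ + x ∈ distDiff q a n := fun j x hx => by
    have := (hH _ (H.sub_mem hx (hpos j)) _ (hblock j)).1
    convert this using 1
    ring
  have hint : ∀ (z : ℤ), ∀ x ∈ H, z * x₀ + x ∈ distDiff q a n := fun z x hx => by
    obtain ⟨j, rfl | rfl⟩ := z.eq_nat_or_neg
    · exact hnat j x hx
    · have := distDiff_neg (hnat j (-x) (H.neg_mem hx))
      convert this using 1
      ring
  -- A generator `g` of `ℤ x₀ + H` divides every `|v_n| + s`, so condition (iv) with `p = |g|`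
  -- forces `|g| = 1`.
  obtain ⟨g, hg⟩ := Int.subgroup_cyclic (AddSubgroup.zmultiples x₀ ⊔ H)
  have hdvd : ∀ i, g ∣ ((genWord q a n).length + spacer q a n i : ℕ) := fun i => by
    have : (((genWord q a n).length + spacer q a n i : ℕ) : ℤ) ∈
        AddSubgroup.zmultiples x₀ ⊔ H := by
      have := AddSubgroup.add_mem_sup (AddSubgroup.mem_zmultiples x₀) (hGH i 0)
      convert this using 1
      push_cast
      ring
    rw [hg, ← AddSubgroup.zmultiples_eq_closure, Int.mem_zmultiples_iff] at this
    exact this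
  have hg1 : g.natAbs = 1 := by
    have hLpos := length_genWord_pos (a := a) hq n
    have hg0 : g.natAbs ≠ 0 := fun h0 => by
      have := hdvd 0
      rw [Int.natAbs_eq_zero.1 h0, zero_dvd_iff] at this
      omega
    by_contra hne
    obtain ⟨m, hm, i, h1, h2, h3⟩ := h g.natAbs (by omega)
    obtain ⟨t, ht⟩ := exists_spacer_eq (a := a) hq hm h1 h2
    rw [← ht] at h3
    exact h3 (Int.natAbs_dvd_natAbs.2 (hdvd t))
  have hc : c ∈ AddSubgroup.zmultiples x₀ ⊔ H := by
    rw [hg, ← AddSubgroup.zmultiples_eq_closure, Int.mem_zmultiples_iff]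
    exact (Int.isUnit_iff_natAbs_eq.2 hg1).dvd
  obtain ⟨y, hy, x, hx, rfl⟩ := AddSubgroup.mem_sup.1 hc
  obtain ⟨z, rfl⟩ := AddSubgroup.mem_zmultiples_iff.1 hy
  exact hint z x hx

/-! ### Weak mixing -/

theorem subshiftHomeo_zpow_apply {A : Type*} [TopologicalSpace A] (X : Subshift A ℤ)
    (x : X.carrier) (l k : ℤ) : ((subshiftHomeo X ^ l) x).1 k = x.1 (k + l) := by
  have hinv : ∀ (x : X.carrier) (k : ℤ), ((subshiftHomeo X)⁻¹ x).1 k = x.1 (k - 1) :=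
    fun x k => by
      have := subshiftHomeo_apply X ((subshiftHomeo X)⁻¹ x) (k - 1)
      rw [sub_add_cancel] at this
      rw [← this, ← Homeomorph.mul_apply, mul_inv_cancel]
      rfl
  induction l generalizing x k with
  | zero => simp
  | succ n ih =>
    rw [zpow_add_one, Homeomorph.mul_apply, ih, subshiftHomeo_apply, add_assoc]
  | pred n ih =>
    rw [zpow_sub_one, Homeomorph.mul_apply, ih, hinv, add_sub_assoc]

theorem exists_occurrence (hq : ∀ n, 1 < q n) {B : ℕ}
    (hB : ∀ n i, 1 ≤ i → i < q n → a n i ≤ B) (x : (rankOneSubshift q a).carrier) (n : ℕ) :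
    ∃ k : ℕ, ∀ t < (genWord q a n).length, x.1 ((k : ℤ) + t) = infWord q a t := by
  -- Length `|v_n| + B` guarantees a block start, and a further `|v_n|` lets that block end inside
  -- the window.
  obtain ⟨m, hm⟩ := x.2 0 (2 * (genWord q a n).length + B)
  obtain ⟨j, h1, h2⟩ := exists_blockPos_mem hq hB n m
  refine ⟨blockPos q a n j - m, fun t ht => ?_⟩
  have := hm (blockPos q a n j - m + t) (by omega)
  rw [← add_assoc, Nat.add_sub_cancel' h1, (infWord_blockPos hq n j).1 t ht] at this
  rw [← this]
  push_cast
  ring_nf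

/-- A cylinder inside `U` is given by a word occurring at a fixed place of `V`, hence at that same
place in every long `v_n`. Each occurrence of `v_n` in a point thus gives a visit to `U` after the
constant delay `c`. -/
theorem exists_forall_mem_of_isOpen (hq : ∀ n, 1 < q n) {U : Set (rankOneSubshift q a).carrier}
    (hU : IsOpen U) (hne : U.Nonempty) :
    ∃ (c : ℤ) (N : ℕ), ∀ n ≥ N, ∀ (x : (rankOneSubshift q a).carrier) (k : ℤ),
      (∀ t < (genWord q a n).length, x.1 (k + t) = infWord q a t) →
        (subshiftHomeo (rankOneSubshift q a) ^ (k + c)) x ∈ U := by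
  obtain ⟨u, hu⟩ := hne
  obtain ⟨W, hW, rfl⟩ := isOpen_induced_iff.1 hU
  obtain ⟨I, f, hf, hI⟩ := isOpen_pi_iff.1 hW u.1 hu
  let K : ℕ := I.sup Int.natAbs
  obtain ⟨m, hm⟩ := u.2 (-K) (2 * K + 1)
  refine ⟨m + K, m + 2 * K, fun n hn x k hx => hI fun i hi => ?_⟩
  have hiK : i.natAbs ≤ K := Finset.le_sup (f := Int.natAbs) hi
  have hlen := lt_length_genWord q a hq n
  have h1 := hm (i + K).toNat (by omega)
  have h2 := hx (m + (i + K).toNat) (by omega)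
  have h3 : (((i + K).toNat : ℕ) : ℤ) = i + K := Int.toNat_of_nonneg (by omega)
  rw [← h1] at h2
  have h4 : ((subshiftHomeo (rankOneSubshift q a) ^ (k + (m + K))) x).1 i = u.1 i := by
    rw [subshiftHomeo_zpow_apply]
    convert h2 using 2
    · push_cast
      rw [h3]
      ring
    · rw [h3]
      ring
  rw [h4]
  exact (hf i hi).2

theorem isWeaklyMixing_rankOneSubshift (hq : ∀ n, 1 < q n) {B : ℕ}
    (hB : ∀ n i, 1 ≤ i → i < q n → a n i ≤ B) [Nonempty (rankOneSubshift q a).carrier]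
    (h : ∀ p : ℕ, 1 < p → ∀ n : ℕ, ∃ m ≥ n, ∃ i : ℕ, 1 ≤ i ∧ i < q m ∧
      ¬ p ∣ (genWord q a n).length + a m i) :
    IsWeaklyMixing (subshiftHomeo (rankOneSubshift q a)) := by
  intro U V W Z hU hV hW hZ hU' hV' hW' hZ'
  obtain ⟨M, hM⟩ := exists_forall_ge_range_spacer_subset hq hB
  obtain ⟨c₁, N₁, h1⟩ := exists_forall_mem_of_isOpen hq hU hU'
  obtain ⟨c₂, N₂, h2⟩ := exists_forall_mem_of_isOpen hq hV hV'
  obtain ⟨c₃, N₃, h3⟩ := exists_forall_mem_of_isOpen hq hW hW'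
  obtain ⟨c₄, N₄, h4⟩ := exists_forall_mem_of_isOpen hq hZ hZ'
  let n := M + N₁ + N₂ + N₃ + N₄
  obtain ⟨k₂, hk₂, k₁, hk₁, k₄, hk₄, k₃, hk₃, hk⟩ :=
    -- This value makes `(k₂ + c₂) - (k₁ + c₁)` equal to `(k₄ + c₄) - (k₃ + c₃)`, the common time
    -- `l`. All four occurrences are then found inside one `v_m` of a single point `x`.
    distDiff_eq_univ hq hM (by omega : M ≤ n) (fun p hp => h p hp n) ((c₄ - c₃) - (c₂ - c₁))
  let m := k₁ + k₂ + k₃ + k₄ + (genWord q a n).length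
  have hm : m < (genWord q a m).length := lt_length_genWord q a hq m
  obtain ⟨k, hkx⟩ := exists_occurrence hq hB
    (Classical.arbitrary (rankOneSubshift q a).carrier) m
  generalize Classical.arbitrary (rankOneSubshift q a).carrier = x at hkx
  have key : ∀ r ∈ blockOcc q a n, r ≤ k₁ + k₂ + k₃ + k₄ →
      ∀ t < (genWord q a n).length, x.1 ((k + r : ℤ) + t) = infWord q a t := by
    intro r hr hrm t ht
    rw [← hr t ht, ← hkx (r + t) (by omega)]
    push_cast
    ring_nf
  have move : ∀ c c' l : ℤ, c' = l + c →
      (subshiftHomeo (rankOneSubshift q a) ^ l) ((subshiftHomeo (rankOneSubshift q a) ^ c) x) =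
        (subshiftHomeo (rankOneSubshift q a) ^ c') x := by
    rintro c c' l rfl
    rw [zpow_add, Homeomorph.mul_apply]
  refine ⟨(k + k₂ + c₂) - (k + k₁ + c₁), ⟨_, ⟨_, h1 n (by omega) x _ (key k₁ hk₁ (by omega)), rfl⟩,
    ?_⟩, ⟨_, ⟨_, h3 n (by omega) x _ (key k₃ hk₃ (by omega)), rfl⟩, ?_⟩⟩
  · rw [move _ (k + k₂ + c₂) _ (by ring)]
    exact h2 n (by omega) x _ (key k₂ hk₂ (by omega))
  · rw [move _ (k + k₄ + c₄) _ (by linarith)]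
    exact h4 n (by omega) x _ (key k₄ hk₄ (by omega))

end

/-! ### Unique readability -/

section

variable {q : ℕ → ℕ} {a : ℕ → ℕ → ℕ}

theorem finite_of_periodic {P : ℕ} (hP : 0 < P)
    (h : ∀ k, infWord q a (k + P) = infWord q a k) :
    Finite (rankOneSubshift q a).carrier := by
  have hper : ∀ x : (rankOneSubshift q a).carrier, ∀ k : ℤ, x.1 (k + P) = x.1 k := fun x k => by
    obtain ⟨m, hm⟩ := x.2 k (P + 1)
    have h0 := hm 0 (by omega)
    rw [hm P (by omega), h, ← Nat.add_zero m, ← h0]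
    simp
  have hmul : ∀ x : (rankOneSubshift q a).carrier, ∀ k z : ℤ, x.1 (k + z * P) = x.1 k := by
    intro x k z
    induction z generalizing k with
    | zero => simp
    | succ n ih => rw [add_mul, ← add_assoc, one_mul, hper, ih]
    | pred n ih => rw [← hper x, sub_mul, one_mul, add_assoc, sub_add_cancel, ih]
  refine Finite.of_injective
    (fun (x : (rankOneSubshift q a).carrier) (j : Fin P) => x.1 (j : ℕ)) fun x y hxy => ?_
  refine Subtype.ext (funext fun k => ?_)
  have hP' : (P : ℤ) ≠ 0 := by omega
  have hk0 := Int.emod_nonneg k hP'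
  have hk1 := Int.emod_lt_of_pos k (show (0 : ℤ) < P by omega)
  have hk : k = ((k % P).toNat : ℕ) + k / P * P := by
    rw [Int.toNat_of_nonneg hk0]
    linarith [Int.emod_add_mul_ediv k P, mul_comm (k / P) (P : ℤ)]
  rw [hk, hmul, hmul]
  exact congrFun hxy ⟨(k % P).toNat, by omega⟩

/-- The number of zeros of the infinite word before position `k`. -/
def zeroCount (q : ℕ → ℕ) (a : ℕ → ℕ → ℕ) (k : ℕ) : ℕ :=
  Nat.count (fun j => infWord q a j = 0) k

theorem zeroCount_add_eq {m m' R : ℕ} (h : ∀ j < R, infWord q a (m + j) = infWord q a (m' + j))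
    {y : ℕ} (hy : y ≤ R) : zeroCount q a (m + y) + zeroCount q a m' =
      zeroCount q a (m' + y) + zeroCount q a m := by
  induction y with
  | zero => simp [add_comm]
  | succ y ih =>
    have h1 := ih (by omega)
    have h2 := h y (by omega)
    simp only [zeroCount, ← add_assoc, Nat.count_succ, h2] at h1 ⊢
    omega

/-- Spacers consist of ones, so each block contributes the same number of zeros. Counting zeros thus
counts blocks, whatever the spacers are. -/
theorem zeroCount_blockPos_add (hq : ∀ n, 1 < q n) (n j : ℕ) {o : ℕ}
    (ho : o ≤ (genWord q a n).length) : zeroCount q a (blockPos q a n j + o) =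
      j * zeroCount q a (genWord q a n).length + zeroCount q a o := by
  have hadd : ∀ j, zeroCount q a (blockPos q a n j + o) =
      zeroCount q a (blockPos q a n j) + zeroCount q a o := fun j => by
    have := zeroCount_add_eq (q := q) (a := a) (m := blockPos q a n j) (m' := 0)
      (R := (genWord q a n).length)
      (fun t ht => by rw [(infWord_blockPos hq n j).1 t ht, zero_add]) ho
    simpa [zeroCount, add_comm] using this
  have hsp : ∀ j, ∀ s ≤ spacer q a n j,
      zeroCount q a (blockPos q a n j + (genWord q a n).length + s) =
        zeroCount q a (blockPos q a n j + (genWord q a n).length) := fun j s hs => by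
    induction s with
    | zero => rfl
    | succ s ih =>
      rw [← ih (by omega), ← add_assoc, zeroCount, zeroCount, Nat.count_succ,
        (infWord_blockPos hq n j).2 s (by omega)]
      simp
  rw [hadd]
  congr 1
  induction j with
  | zero => simp [zeroCount]
  | succ j ih =>
    have h1 := zeroCount_add_eq (q := q) (a := a) (m := blockPos q a n j) (m' := 0)
      (R := (genWord q a n).length)
      (fun t ht => by rw [(infWord_blockPos hq n j).1 t ht, zero_add]) le_rfl
    rw [blockPos_succ, hsp j _ le_rfl, add_mul, one_mul, ← ih]
    simpa [zeroCount, add_comm] using h1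

theorem exists_eq_blockPos_add (hq : ∀ n, 1 < q n) (n : ℕ) {k : ℕ} (hk : infWord q a k = 0) :
    ∃ j o, o < (genWord q a n).length ∧ k = blockPos q a n j + o := by
  obtain ⟨j, h1, h2⟩ := exists_blockPos_le_lt (a := a) hq n k
  refine ⟨j, k - blockPos q a n j, ?_, by omega⟩
  by_contra hlt
  rw [blockPos_succ] at h2
  have := (infWord_blockPos (a := a) hq n j).2
    (k - blockPos q a n j - (genWord q a n).length) (by omega)
  rw [show blockPos q a n j + (genWord q a n).length +
    (k - blockPos q a n j - (genWord q a n).length) = k by omega, hk] at this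
  exact absurd this (by decide)

/-- If `V` agrees on two windows, then the offset between the block structures of
the two windows does not change along them. -/
theorem blockPos_offset (hq : ∀ n, 1 < q n) {n m m' R : ℕ}
    (h : ∀ j < R, infWord q a (m + j) = infWord q a (m' + j)) {t t' o x : ℕ}
    (ho : o < (genWord q a n).length) (hx : blockPos q a n t = m + x)
    (hx' : m' + x = blockPos q a n t' + o) {i y : ℕ} (hy : blockPos q a n (t + i) = m + y)
    (hyR : y < R) : m' + y = blockPos q a n (t' + i) + o := by
  have hxy : x ≤ y := by
    have := (blockPos_strictMono (a := a) hq n).monotone (Nat.le_add_right t i)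
    omega
  have hL := length_genWord_pos (a := a) hq n
  have hstart : ∀ j, infWord q a (blockPos q a n j) = 0 := fun j => by
    have := (infWord_blockPos (a := a) hq n j).1 0 hL
    rwa [add_zero, infWord_zero] at this
  have hz : infWord q a (m' + y) = 0 := by
    rw [← h y hyR, ← hy, hstart]
  have hz' : infWord q a (blockPos q a n (t' + i) + o) = 0 := by
    rw [(infWord_blockPos hq n _).1 o ho, ← (infWord_blockPos hq n t').1 o ho, ← hx',
      ← h x (by omega), ← hx, hstart]
  -- Both positions carry a zero, and two zeros preceded by equally many zeros coincide.
  refine Nat.count_injective (p := fun j => infWord q a j = 0) hz hz' ?_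
  have e1 := zeroCount_add_eq h hyR.le
  have e2 := zeroCount_add_eq h (hxy.trans hyR.le)
  have e3 := zeroCount_blockPos_add (a := a) hq n (t' + i) ho.le
  have e4 := zeroCount_blockPos_add (a := a) hq n t' ho.le
  have e5 := zeroCount_blockPos_add (a := a) hq n (t + i) (Nat.zero_le _)
  have e6 := zeroCount_blockPos_add (a := a) hq n t (Nat.zero_le _)
  rw [add_zero, hy] at e5
  rw [add_zero, hx] at e6
  rw [← hx'] at e4
  change zeroCount q a (m' + y) = zeroCount q a (blockPos q a n (t' + i) + o)
  rw [add_mul] at e3 e5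
  omega

/-- If `V` agrees on two long windows with different block structures, then it contains a
long periodic word. -/
theorem exists_period_of_offset (hq : ∀ n, 1 < q n) {B : ℕ}
    (hB : ∀ n i, 1 ≤ i → i < q n → a n i ≤ B) {n m m' R : ℕ}
    (h : ∀ j < R, infWord q a (m + j) = infWord q a (m' + j)) {t t' o x : ℕ}
    (ho : 0 < o) (hoL : o < (genWord q a n).length) (hx : blockPos q a n t = m + x)
    (hx' : m' + x = blockPos q a n t' + o)
    (hR : x + 5 * ((genWord q a n).length + B) ≤ R) :
    ∃ P, 0 < P ∧ P < 2 * (genWord q a n).length ∧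
      ∀ y, blockPos q a n (t + 1) ≤ y → y + 3 * ((genWord q a n).length + B) ≤ m + R →
        infWord q a (y + P) = infWord q a y := by
  have hmono := blockPos_strictMono (a := a) hq n
  have hsucc := blockPos_succ_le (a := a) hq hB n
  have hsuc := blockPos_succ (q := q) (a := a) n
  have hL := length_genWord_pos (a := a) hq n
  have b1 := hsucc t'
  have b2 := hsuc t'
  obtain ⟨y₁, hy₁⟩ : ∃ y₁, blockPos q a n (t' + 1) = m' + y₁ :=
    ⟨blockPos q a n (t' + 1) - m', by omega⟩
  have hz : infWord q a (m + y₁) = 0 := by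
    have := (infWord_blockPos (a := a) hq n (t' + 1)).1 0 hL
    rw [h y₁ (by omega), ← hy₁]
    rwa [add_zero, infWord_zero] at this
  obtain ⟨t'', o'', ho'', hy₁'⟩ := exists_eq_blockPos_add hq n hz
  -- Comparing first to second window gives offset `o`, and comparing back gives `o''`. Their
  -- composition compares the block structure of `V` with itself, shifted by `P = o + o''`.
  have shift : ∀ i, blockPos q a n (t + 1 + i) < m + R →
      blockPos q a n (t + 1 + i) = blockPos q a n (t'' + i) + (o + o'') := by
    intro i hi
    have hm1 : blockPos q a n t ≤ blockPos q a n (t + 1 + i) := hmono.monotone (by omega)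
    obtain ⟨y, hy⟩ : ∃ y, blockPos q a n (t + 1 + i) = m + y :=
      ⟨blockPos q a n (t + 1 + i) - m, by omega⟩
    have h1 := blockPos_offset hq h hoL hx hx' (i := 1 + i) (by rw [← add_assoc]; exact hy)
      (by omega)
    rw [← add_assoc] at h1
    have hm2 : blockPos q a n (t' + 1) ≤ blockPos q a n (t' + 1 + i) := hmono.monotone (by omega)
    have h2 := blockPos_offset hq (fun j hj => (h j hj).symm) ho'' hy₁ hy₁' (i := i)
      (y := y - o) (by omega) (by omega)
    omega
  have b3 := hsucc t
  have s0 := shift 0 (by simp only [add_zero]; omega)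
  simp only [add_zero] at s0
  refine ⟨o + o'', by omega, by omega, fun y hy hyR => ?_⟩
  have shift' : ∀ i, blockPos q a n (t'' + i) ≤ y →
      blockPos q a n (t + 1 + i) = blockPos q a n (t'' + i) + (o + o'') := by
    intro i
    induction i with
    | zero => intro _; exact s0
    | succ i ih =>
      intro hi
      have hm3 : blockPos q a n (t'' + i) < blockPos q a n (t'' + (i + 1)) := hmono (by omega)
      have := ih (by omega)
      have b4 := hsucc (t + 1 + i)
      exact shift (i + 1) (by rw [← add_assoc]; omega)
  obtain ⟨k, hk1, hk2⟩ := exists_blockPos_le_lt (a := a) hq n y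
  obtain ⟨i, rfl⟩ : ∃ i, k = t'' + i := by
    have h1 : blockPos q a n t'' < blockPos q a n (k + 1) := by omega
    have h2 := hmono.lt_iff_lt.1 h1
    exact ⟨k - t'', by omega⟩
  have e1 := shift' i hk1
  have b4 := hsucc (t + 1 + i)
  have e2 := shift (i + 1) (by rw [← add_assoc]; omega)
  rw [← add_assoc (t + 1) i 1, ← add_assoc t'' i 1] at e2
  have b5 := hsuc (t + 1 + i)
  have b6 := hsuc (t'' + i)
  obtain ⟨j, rfl⟩ := Nat.exists_eq_add_of_le hk1
  rw [add_right_comm, ← e1]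
  -- Consecutive block starts match under the shift by `P`, so the spacers match as well, and
  -- letters agree inside blocks and inside spacers.
  by_cases hj : j < (genWord q a n).length
  · rw [(infWord_blockPos hq n _).1 j hj, (infWord_blockPos hq n _).1 j hj]
  · obtain ⟨s, rfl⟩ := Nat.exists_eq_add_of_le (not_lt.1 hj)
    rw [← add_assoc, ← add_assoc, (infWord_blockPos hq n _).2 s (by omega),
      (infWord_blockPos hq n _).2 s (by omega)]

/-- Equal windows at incongruent positions have a nonzero block offset, hence a stretch of some
period `P < 2 |v_n|`. One `v_N` contains a failure of each such period and recurs in every long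
stretch, a contradiction. -/
theorem exists_window_modEq (hq : ∀ n, 1 < q n) {B : ℕ}
    (hB : ∀ n i, 1 ≤ i → i < q n → a n i ≤ B) (hinf : Infinite (rankOneSubshift q a).carrier)
    {p n : ℕ} (hp : ∀ m ≥ n, ∀ i, 1 ≤ i → i < q m → p ∣ (genWord q a n).length + a m i) :
    ∃ R, ∀ m m', (∀ j < R, infWord q a (m + j) = infWord q a (m' + j)) → m ≡ m' [MOD p] := by
  have hdvd : ∀ j, p ∣ blockPos q a n j := fun j => by
    induction j with
    | zero => simp
    | succ j ih =>
      obtain ⟨m, hm, i, h1, h2, h3⟩ := exists_eq_spacer (a := a) hq n j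
      rw [blockPos_succ, add_assoc, h3]
      exact dvd_add ih (hp m hm i h1 h2)
  have hnp : ∀ P, 0 < P → ∃ k, infWord q a (k + P) ≠ infWord q a k := fun P hP => by
    by_contra! hcon
    exact not_finite_iff_infinite.2 hinf (finite_of_periodic hP hcon)
  choose! k hk using hnp
  let N := ∑ P ∈ Finset.range (2 * (genWord q a n).length), (k P + P)
  have hN : ∀ P < 2 * (genWord q a n).length, k P + P ≤ N := fun P hP =>
    Finset.single_le_sum (f := fun P => k P + P) (fun _ _ => Nat.zero_le _)
      (Finset.mem_range.2 hP)
  have hNL := lt_length_genWord q a hq N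
  -- The first summand pays for reaching a block start and for the margins of
  -- `exists_period_of_offset`; the second leaves room for a full copy of `v_N`.
  refine ⟨10 * ((genWord q a n).length + B) + 2 * ((genWord q a N).length + B), fun m m' h => ?_⟩
  by_contra hne
  obtain ⟨t, h1, h2⟩ := exists_blockPos_mem hq hB n m
  obtain ⟨x, hx⟩ := Nat.exists_eq_add_of_le h1
  have hz : infWord q a (m' + x) = 0 := by
    have := (infWord_blockPos (a := a) hq n t).1 0 (length_genWord_pos hq n)
    rw [← h x (by omega), ← hx]
    rwa [add_zero, infWord_zero] at this
  obtain ⟨t', o, ho, hx'⟩ := exists_eq_blockPos_add hq n hz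
  have ho0 : 0 < o := by
    rw [Nat.pos_iff_ne_zero]
    rintro rfl
    refine hne (Nat.ModEq.add_right_cancel' x ?_)
    rw [← hx, hx', add_zero]
    exact ((Nat.modEq_zero_iff_dvd.2 (hdvd t))).trans (Nat.modEq_zero_iff_dvd.2 (hdvd t')).symm
  obtain ⟨P, hP, hPL, hper⟩ := exists_period_of_offset hq hB h ho0 ho hx hx' (by omega)
  obtain ⟨u, hu1, hu2⟩ := exists_blockPos_mem hq hB N (blockPos q a n (t + 1))
  have b1 := blockPos_succ_le hq hB n t
  have hNP := hN P hPL
  have e := hper (blockPos q a N u + k P) (by omega) (by omega)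
  rw [add_assoc, (infWord_blockPos hq N u).1 _ (by omega),
    (infWord_blockPos hq N u).1 _ (by omega)] at e
  exact hk P hP e

/-! ### Cyclic factors -/

theorem exists_cyclic_quotient (hq : ∀ n, 1 < q n) {B : ℕ}
    (hB : ∀ n i, 1 ≤ i → i < q n → a n i ≤ B) (hinf : Infinite (rankOneSubshift q a).carrier)
    {p n : ℕ} (hp0 : 0 < p)
    (hp : ∀ m ≥ n, ∀ i, 1 ≤ i → i < q m → p ∣ (genWord q a n).length + a m i) :
    ∃ φ : (rankOneSubshift q a).carrier → ZMod p, IsLocallyConstant φ ∧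
      Function.Surjective φ ∧ ∀ x, φ (subshiftHomeo (rankOneSubshift q a) x) = φ x + 1 := by
  classical
  obtain ⟨R, hR⟩ := exists_window_modEq hq hB hinf hp
  -- The residue does not depend on the chosen occurrence, by `hR`. The default `0` is never used on
  -- points of the subshift, all of whose windows occur in `V`.
  let F : (Fin R → Fin 2) → ZMod p := fun w =>
    if h : ∃ m : ℕ, ∀ j : Fin R, w j = infWord q a (m + j) then (h.choose : ZMod p) else 0
  let restr : (rankOneSubshift q a).carrier → Fin R → Fin 2 := fun x j => x.1 (j : ℕ)
  have hF : ∀ x : (rankOneSubshift q a).carrier, ∀ m : ℕ,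
      (∀ j < R, x.1 (j : ℕ) = infWord q a (m + j)) → F (restr x) = m := fun x m hm => by
    have hex : ∃ m : ℕ, ∀ j : Fin R, restr x j = infWord q a (m + j) := ⟨m, fun j => hm j j.2⟩
    change (if h : _ then _ else _) = _
    rw [dif_pos hex, ZMod.natCast_eq_natCast_iff]
    exact hR _ _ fun j hj => by rw [← hm j hj]; exact (hex.choose_spec ⟨j, hj⟩).symm
  have hcont : Continuous restr :=
    continuous_pi fun j => (continuous_apply _).comp continuous_subtype_val
  have hsemi : ∀ x, F (restr (subshiftHomeo (rankOneSubshift q a) x)) = F (restr x) + 1 := by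
    intro x
    obtain ⟨m, hm⟩ := x.2 0 (R + 1)
    simp only [zero_add] at hm
    rw [hF x m fun j hj => hm j (by omega), hF _ (m + 1), Nat.cast_add, Nat.cast_one]
    intro j hj
    have := hm (j + 1) (by omega)
    rw [subshiftHomeo_apply, add_right_comm, add_assoc m, ← this]
    simp
  refine ⟨F ∘ restr, (IsLocallyConstant.of_discrete F).comp_continuous hcont, fun y => ?_, hsemi⟩
  have : NeZero p := ⟨hp0.ne'⟩
  obtain ⟨x⟩ : Nonempty (rankOneSubshift q a).carrier := inferInstance
  have hiter : ∀ i : ℕ, ∃ z, F (restr z) = F (restr x) + i := fun i => by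
    induction i with
    | zero => exact ⟨x, by simp⟩
    | succ i ih =>
      obtain ⟨z, hz⟩ := ih
      exact ⟨_, by rw [hsemi z, hz, Nat.cast_succ, add_assoc]⟩
  obtain ⟨z, hz⟩ := hiter (y - F (restr x)).val
  exact ⟨z, by simp [hz]⟩

end

theorem mainTheorem2 (q : ℕ → ℕ) (a : ℕ → ℕ → ℕ)
    (hq : ∀ n, 1 < q n)
    (hbdd : ∃ B : ℕ, ∀ n i, 1 ≤ i → i < q n → a n i ≤ B)
    (hinf : Infinite (rankOneSubshift q a).carrier) :
    List.TFAE [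
      IsWeaklyMixing (subshiftHomeo (rankOneSubshift q a)),
      IsMaximalEquicontinuousFactor (subshiftHomeo (rankOneSubshift q a))
        (id : PUnit.{u + 1} → PUnit.{u + 1}),
      ∀ (Y : Type u) [MetricSpace Y] [CompactSpace Y] (S : Y → Y), Continuous S → Finite Y →
        IsFactor (subshiftHomeo (rankOneSubshift q a)) S → Nat.card Y = 1,
      ∀ p : ℕ, 1 < p → ∀ n : ℕ, ∃ m ≥ n, ∃ i : ℕ, 1 ≤ i ∧ i < q m ∧
        ¬ p ∣ (genWord q a n).length + a m i] := by
  obtain ⟨B, hB⟩ := hbdd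
  tfae_have 1 → 2 := fun h => h.isMaximalEquicontinuousFactor_punit
  tfae_have 2 → 3 := fun h Y _ _ S _ _ hS => h.card_eq_one Y S hS
  tfae_have 3 → 4 := by
    intro h p hp n
    by_contra! hcon
    obtain ⟨φ, hφ, hsurj, hsemi⟩ := exists_cyclic_quotient hq hB hinf (by omega) hcon
    have : NeZero p := ⟨by omega⟩
    -- `ULift` places `ℤ/p` in the universe over which the finite factors range.
    have hcard := card_eq_one_of_isLocallyConstant h (Y := ULift (ZMod p))
      (S := fun y => ULift.up (y.down + 1)) (hφ.comp ULift.up)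
      (ULift.up_surjective.comp hsurj) (fun x => congrArg ULift.up (hsemi x))
    rw [Nat.card_ulift, Nat.card_zmod] at hcard
    omega
  tfae_have 4 → 1 := fun h => isWeaklyMixing_rankOneSubshift hq hB h
  tfae_finish
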